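/- Let $\mathbf X_N\subseteq\mathcal X$ be a finite set of $N$ input points, let $\ell:\mathcal Y\times\mathcal Y\to[0,1]$ be a loss function, $\phi:\mathcal X\to\mathcal Y$ a (deterministic) target function and $\mathcal H$ an arbitrary set of functions $h:\mathcal X\to\mathcal Y$; write $\ell_h(X)=\ell(h(X),\phi(X))$. Let $1\le m\le N$ and let $\mathbf X_m\subseteq\mathbf X_N$ be a random $m$-element subset sampled uniformly without replacement from $\mathbf X_N$. Put $$L_N(h)=\frac1N\sum_{X\in\mathbf X_N}\ell_h(X),\qquad \hat L_m(h)=\frac1m\sum_{X\in\mathbf X_m}\ell_h(X),\qquad \sigma_{\mathcal H}^2=\sup_{h\in\mathcal H}\frac1N\sum_{X\in\mathbf X_N}\bigl(\ell_h(X)-L_N(h)\bigr)^2 .$$ Then for every $t\ge 0$, with probability (strictly) greater than $1-e^{-t}$ the following holds: for all $h\in\mathcal H$, $$L_N(h)-\hat L_m(h)\;\le\;\mathbb E\Bigl[\sup_{g\in\mathcal H}\bigl(L_N(g)-\hat L_m(g)\bigr)\Bigr]+2\sqrt{2\Bigl(\frac{N}{m^2}\Bigr)\sigma_{\mathcal H}^2\,t}\,.$$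 -/

import Mathlib

open MeasureTheory

noncomputable section

/-- The loss `ℓ_h(x) = ℓ(h(x), φ(x))` of the hypothesis `h` at the input `x`, where `φ` is the
deterministic target function that produces the labels. -/
def pointLoss {X Y : Type*} (ℓ : Y → Y → ℝ) (φ : X → Y) (h : X → Y) (x : X) : ℝ :=
  ℓ (h x) (φ x)

/-- The average loss of `h` over a finite set `S` of inputs. For the full set of inputs this is the
overall error `L_N(h)`; for the training inputs it is the training error. -/
def averageLoss {X Y : Type*} (ℓ : Y → Y → ℝ) (φ : X → Y) (S : Finset X) (h : X → Y) : ℝ :=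
  (1 / (S.card : ℝ)) * ∑ x ∈ S, pointLoss ℓ φ h x

/-- `sup_{h ∈ H} (L_N(h) - L̂_m(h))` for the full set of inputs `XN` and the training inputs `S`. -/
def supDeviation {X Y : Type*} (ℓ : Y → Y → ℝ) (φ : X → Y) (H : Set (X → Y))
    (XN S : Finset X) : ℝ :=
  ⨆ h : H, (averageLoss ℓ φ XN h - averageLoss ℓ φ S h)

/-- `σ_H² = sup_{h ∈ H} (1/N) ∑_{x ∈ XN} (ℓ_h(x) - L_N(h))²`. -/
def supVariance {X Y : Type*} (ℓ : Y → Y → ℝ) (φ : X → Y) (H : Set (X → Y))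
    (XN : Finset X) : ℝ :=
  ⨆ h : H, (1 / (XN.card : ℝ)) * ∑ x ∈ XN, (pointLoss ℓ φ h x - averageLoss ℓ φ XN h) ^ 2

/-- The random finite set `Xm` is sampled uniformly without replacement from `XN` with size `m`:
each of the `m`-element subsets of `XN` is drawn with the same probability `1 / (N choose m)`.
(For a probability measure and `m ≤ N` these probabilities add up to one, so that almost surely
`Xm` is an `m`-element subset of `XN`.) -/
def IsUniformSample {Ω X : Type*} [MeasurableSpace Ω] (μ : Measure Ω) (XN : Finset X) (m : ℕ)
    (Xm : Ω → Finset X) : Prop :=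
  ∀ A ∈ XN.powersetCard m,
    MeasurableSet {ω | Xm ω = A} ∧ μ.real {ω | Xm ω = A} = 1 / (XN.card.choose m : ℝ)

end

/-! The maximal deviation `g A = supDeviation ℓ φ H XN A` is a function on the slice of `m`-subsets
of an `N`-set, and the theorem is Gaussian concentration for `g` under the uniform measure, obtained
by the entropy method for the walk that exchanges one point of `A` with one point outside.

The main input is a modified logarithmic Sobolev inequality with constant `N + 2`, independent of
`m` (`finsetEntropy_le_exchangeEnergy`). It is proved by induction on `N`: conditioning on whether
`i ∈ A` splits the entropy into two entropies on smaller slices and a two-point entropy, the latter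
being paid for by the exchanges that remove `i`; averaging over `i` closes the induction.

For `f = exp (r * g)` the energy is at most `2 * V * r ^ 2 * ∑ f`, where `V` bounds the sum of
squared decreases of `g` over all exchanges from a subset. Herbst's argument then gives the tail
`exp (-(N + 2) * ε ^ 2 / (8 * V))` (`card_filter_lt_le`).

Finally, a near-maximiser `h` for `A` controls all decreases of `g` from `A` at once, and the sum of
its squared loss differences across the cut is at most `N` times the sum of squared deviations from
its mean. Hence `V = N ^ 2 / m ^ 2 * σ ^ 2` is admissible (`exchangeVariation_supDeviation_le`), and
the stated threshold gives the exponent `t * (N + 2) / N`. -/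

/-! ### Log-sum and two-point entropy inequalities -/

/-- The symmetrised relative-entropy integrand `(u - v) (log u - log v)`. -/
noncomputable def logDirichlet (u v : ℝ) : ℝ := (u - v) * (Real.log u - Real.log v)

theorem logDirichlet_nonneg {u v : ℝ} (hu : 0 < u) (hv : 0 < v) : 0 ≤ logDirichlet u v := by
  unfold logDirichlet
  rcases le_total u v with h | h
  · have := Real.log_le_log hu h
    nlinarith
  · have := Real.log_le_log hv h
    nlinarith

/-- The function `u * log (u / v)` is jointly convex and homogeneous of degree one; the left side is
its tangent plane at `(a, b)`. -/
theorem mul_log_sub_log_tangent {u v a b : ℝ} (hu : 0 < u) (hv : 0 < v) (ha : 0 < a)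
    (hb : 0 < b) :
    u * (Real.log a - Real.log b) + u - v * (a / b) ≤ u * (Real.log u - Real.log v) := by
  have h := Real.one_sub_inv_le_log_of_pos (x := u * b / (v * a)) (by positivity)
  rw [Real.log_div (by positivity) (by positivity), Real.log_mul hu.ne' hb.ne',
    Real.log_mul hv.ne' ha.ne', inv_div] at h
  have h2 := mul_le_mul_of_nonneg_left h hu.le
  have : u * (1 - v * a / (u * b)) = u - v * (a / b) := by field_simp
  rw [this] at h2
  linarith

/-- The log-sum inequality for the symmetrised relative entropy. -/
theorem card_mul_logDirichlet_le_sum {ι : Type*} (s : Finset ι) (u v : ι → ℝ) (M a b : ℝ)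
    (hu : ∀ i ∈ s, 0 < u i) (hv : ∀ i ∈ s, 0 < v i) (ha : 0 < a) (hb : 0 < b)
    (hua : ∑ i ∈ s, u i = M * a) (hvb : ∑ i ∈ s, v i = M * b) :
    M * logDirichlet a b ≤ ∑ i ∈ s, logDirichlet (u i) (v i) := by
  have h1 : ∑ i ∈ s, (u i * (Real.log a - Real.log b) + u i - v i * (a / b)) ≤
      ∑ i ∈ s, u i * (Real.log (u i) - Real.log (v i)) :=
    Finset.sum_le_sum fun i hi => mul_log_sub_log_tangent (hu i hi) (hv i hi) ha hb
  have h2 : ∑ i ∈ s, (v i * (Real.log b - Real.log a) + v i - u i * (b / a)) ≤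
      ∑ i ∈ s, v i * (Real.log (v i) - Real.log (u i)) :=
    Finset.sum_le_sum fun i hi => mul_log_sub_log_tangent (hv i hi) (hu i hi) hb ha
  have h3 : ∑ i ∈ s, logDirichlet (u i) (v i) =
      ∑ i ∈ s, u i * (Real.log (u i) - Real.log (v i)) +
        ∑ i ∈ s, v i * (Real.log (v i) - Real.log (u i)) := by
    rw [← Finset.sum_add_distrib]
    refine Finset.sum_congr rfl fun i _ => ?_
    unfold logDirichlet
    ring
  simp only [Finset.sum_sub_distrib, Finset.sum_add_distrib, ← Finset.sum_mul, hua, hvb] at h1 h2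
  have e1 : M * b * (a / b) = M * a := by field_simp
  have e2 : M * a * (b / a) = M * b := by field_simp
  rw [e1] at h1
  rw [e2] at h2
  rw [h3]
  unfold logDirichlet
  linarith

/-- Entropy of a two-point distribution is at most the covariance with the logarithm. -/
theorem two_point_entropy_le {p q a b : ℝ} (hp : 0 ≤ p) (hq : 0 ≤ q) (hpq : p + q = 1)
    (ha : 0 < a) (hb : 0 < b) :
    p * (a * Real.log a) + q * (b * Real.log b) - (p * a + q * b) * Real.log (p * a + q * b) ≤
      p * q * logDirichlet a b := by
  have h := strictConcaveOn_log_Ioi.concaveOn.2 (Set.mem_Ioi.2 ha) (Set.mem_Ioi.2 hb) hp hq hpq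
  simp only [smul_eq_mul] at h
  have h2 := mul_le_mul_of_nonneg_left h (by positivity : 0 ≤ p * a + q * b)
  have hq' : q = 1 - p := by linarith
  have : p * (a * Real.log a) + q * (b * Real.log b) -
      (p * a + q * b) * (p * Real.log a + q * Real.log b) = p * q * logDirichlet a b := by
    unfold logDirichlet
    subst hq'
    ring
  linarith

/-! ### Modified logarithmic Sobolev inequality on the slice -/

/-- The entropy of `f` for the counting measure on `s`. -/
noncomputable def finsetEntropy {ι : Type*} (s : Finset ι) (f : ι → ℝ) : ℝ :=
  ∑ x ∈ s, f x * Real.log (f x) - (∑ x ∈ s, f x) * Real.log ((∑ x ∈ s, f x) / s.card)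

/-- The modified Dirichlet form of the Bernoulli–Laplace exchange process on the `k`-element
subsets of `U`. -/
noncomputable def exchangeEnergy {α : Type*} [DecidableEq α] (U : Finset α) (k : ℕ) (f : Finset α → ℝ) : ℝ :=
  ∑ A ∈ U.powersetCard k, ∑ i ∈ A, ∑ j ∈ U \ A, logDirichlet (f A) (f (insert j (A.erase i)))

theorem exchangeEnergy_nonneg {α : Type*} [DecidableEq α] (U : Finset α) (k : ℕ)
    {f : Finset α → ℝ} (hf : ∀ A, 0 < f A) : 0 ≤ exchangeEnergy U k f :=
  Finset.sum_nonneg fun _ _ => Finset.sum_nonneg fun _ _ => Finset.sum_nonneg fun _ _ =>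
    logDirichlet_nonneg (hf _) (hf _)

theorem sum_powersetCard_succ_erase {α : Type*} [DecidableEq α] {U : Finset α} {i : α}
    (hi : i ∈ U) (k : ℕ) (F : Finset α → ℝ) :
    ∑ A ∈ U.powersetCard (k + 1), F A =
      ∑ A ∈ (U.erase i).powersetCard k, F (insert i A) +
        ∑ A ∈ (U.erase i).powersetCard (k + 1), F A := by
  have h : i ∉ U.erase i := Finset.notMem_erase i U
  conv_lhs => rw [← Finset.insert_erase hi, Finset.powersetCard_succ_insert h]
  rw [Finset.sum_union, add_comm, Finset.sum_image]
  · intro A hA B hB hAB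
    have hA' : i ∉ A := fun hh => h ((Finset.mem_powersetCard.1 hA).1 hh)
    have hB' : i ∉ B := fun hh => h ((Finset.mem_powersetCard.1 hB).1 hh)
    rw [← Finset.erase_insert hA', ← Finset.erase_insert hB', hAB]
  · rw [Finset.disjoint_left]
    intro A hA hA'
    obtain ⟨B, _, rfl⟩ := Finset.mem_image.1 hA'
    exact h ((Finset.mem_powersetCard.1 hA).1 (Finset.mem_insert_self i B))

/-- Double counting: a set `B` of size `k + 1` arises from `k + 1` pairs, one for each choice of the
inserted point. -/
theorem sum_powersetCard_sum_insert {α : Type*} [DecidableEq α] (V : Finset α) (k : ℕ)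
    (g : Finset α → ℝ) :
    ∑ A ∈ V.powersetCard k, ∑ j ∈ V \ A, g (insert j A) =
      (k + 1) * ∑ B ∈ V.powersetCard (k + 1), g B := by
  have h : (k + 1 : ℝ) * ∑ B ∈ V.powersetCard (k + 1), g B =
      ∑ B ∈ V.powersetCard (k + 1), ∑ _j ∈ B, g B := by
    rw [Finset.mul_sum]
    refine Finset.sum_congr rfl fun B hB => ?_
    rw [Finset.sum_const, (Finset.mem_powersetCard.1 hB).2, nsmul_eq_mul]
    push_cast
    ring
  rw [h, Finset.sum_sigma', Finset.sum_sigma']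
  refine Finset.sum_bij' (fun x _ => ⟨insert x.2 x.1, x.2⟩) (fun x _ => ⟨x.1.erase x.2, x.2⟩)
    ?_ ?_ ?_ ?_ ?_
  · rintro ⟨A, j⟩ hx
    simp only [Finset.mem_sigma, Finset.mem_powersetCard, Finset.mem_sdiff] at hx ⊢
    obtain ⟨⟨hA, hc⟩, hj, hjA⟩ := hx
    refine ⟨⟨Finset.insert_subset hj hA, ?_⟩, Finset.mem_insert_self _ _⟩
    rw [Finset.card_insert_of_notMem hjA, hc]
  · rintro ⟨B, j⟩ hx
    simp only [Finset.mem_sigma, Finset.mem_powersetCard, Finset.mem_sdiff] at hx ⊢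
    obtain ⟨⟨hB, hc⟩, hj⟩ := hx
    refine ⟨⟨(Finset.erase_subset _ _).trans hB, ?_⟩, hB hj, Finset.notMem_erase _ _⟩
    rw [Finset.card_erase_of_mem hj, hc]
    rfl
  · rintro ⟨A, j⟩ hx
    simp only [Finset.mem_sigma, Finset.mem_sdiff] at hx
    simp [Finset.erase_insert hx.2.2]
  · rintro ⟨B, j⟩ hx
    simp only [Finset.mem_sigma] at hx
    simp [Finset.insert_erase hx.2]
  · rintro ⟨A, j⟩ _
    rfl

/-- Exchanges that leave the membership of `i` unchanged. -/
theorem exchangeEnergy_erase_add {α : Type*} [DecidableEq α] {U : Finset α} {i : α}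
    (hi : i ∈ U) (k : ℕ) (f : Finset α → ℝ) :
    exchangeEnergy (U.erase i) k (fun A => f (insert i A)) +
        exchangeEnergy (U.erase i) (k + 1) f =
      ∑ A ∈ U.powersetCard (k + 1), ∑ a ∈ A, ∑ b ∈ U \ A,
        if i ≠ a ∧ i ≠ b then logDirichlet (f A) (f (insert b (A.erase a))) else 0 := by
  rw [sum_powersetCard_succ_erase hi]
  have key : ∀ A, A ∈ (U.erase i).powersetCard k ∨ A ∈ (U.erase i).powersetCard (k + 1) →
      i ∉ A := by
    rintro A (hA | hA) hh <;>
    exact Finset.notMem_erase i U ((Finset.mem_powersetCard.1 hA).1 hh)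
  congr 1
  · refine Finset.sum_congr rfl fun A hA => ?_
    have hiA := key A (Or.inl hA)
    rw [Finset.sum_insert hiA]
    have hset : U \ insert i A = U.erase i \ A := by
      ext x; simp only [Finset.mem_sdiff, Finset.mem_insert, Finset.mem_erase]; tauto
    simp only [ne_eq, not_true_eq_false, false_and, if_false, Finset.sum_const_zero, zero_add, hset]
    refine Finset.sum_congr rfl fun a ha => Finset.sum_congr rfl fun b hb => ?_
    have h1 : i ≠ a := fun h => hiA (h ▸ ha)
    have h2 : i ≠ b := fun h => by simp [← h] at hb
    rw [if_pos ⟨h1, h2⟩, Finset.erase_insert_of_ne h1, Finset.insert_comm]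
  · refine Finset.sum_congr rfl fun A hA => ?_
    have hiA := key A (Or.inr hA)
    refine Finset.sum_congr rfl fun a ha => ?_
    have h1 : i ≠ a := fun h => hiA (h ▸ ha)
    have hset : U.erase i \ A = (U \ A).filter (fun b => i ≠ b) := by
      ext x; simp only [Finset.mem_sdiff, Finset.mem_filter, Finset.mem_erase]; tauto
    simp only [h1, ne_eq, not_false_eq_true, true_and]
    rw [hset, Finset.sum_filter]

/-- An exchange of `a` and `b` leaves the membership of `i` unchanged for all `i` but two, so it is
counted `U.card - 2` times. -/
theorem sum_exchangeEnergy_erase {α : Type*} [DecidableEq α] (U : Finset α) (k : ℕ)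
    (f : Finset α → ℝ) :
    ∑ i ∈ U, (exchangeEnergy (U.erase i) k (fun A => f (insert i A)) +
        exchangeEnergy (U.erase i) (k + 1) f) =
      ((U.card : ℝ) - 2) * exchangeEnergy U (k + 1) f := by
  rw [Finset.sum_congr rfl fun i hi => exchangeEnergy_erase_add hi k f, Finset.sum_comm]
  unfold exchangeEnergy
  rw [Finset.mul_sum]
  refine Finset.sum_congr rfl fun A hA => ?_
  rw [Finset.sum_comm, Finset.mul_sum]
  refine Finset.sum_congr rfl fun a ha => ?_
  rw [Finset.sum_comm, Finset.mul_sum]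
  refine Finset.sum_congr rfl fun b hb => ?_
  have haU : a ∈ U := (Finset.mem_powersetCard.1 hA).1 ha
  have hbU : b ∈ U := (Finset.mem_sdiff.1 hb).1
  have hab : b ≠ a := fun h => (Finset.mem_sdiff.1 hb).2 (h ▸ ha)
  rw [← Finset.sum_filter, Finset.sum_const, nsmul_eq_mul]
  have hset : U.filter (fun i => i ≠ a ∧ i ≠ b) = (U.erase a).erase b := by
    ext x; simp only [Finset.mem_filter, Finset.mem_erase]; tauto
  have h1 := Finset.card_erase_add_one haU
  have h2 := Finset.card_erase_add_one (Finset.mem_erase.2 ⟨hab, hbU⟩)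
  rw [hset, ← h1, ← h2]
  push_cast
  ring

/-- Exchanges that remove `i`. -/
noncomputable def exchangeEnergyAt {α : Type*} [DecidableEq α] (U : Finset α) (k : ℕ) (f : Finset α → ℝ)
    (i : α) : ℝ :=
  ∑ A ∈ (U.erase i).powersetCard k, ∑ j ∈ U.erase i \ A,
    logDirichlet (f (insert i A)) (f (insert j A))

/-- Every exchange removes exactly one point. -/
theorem sum_exchangeEnergyAt {α : Type*} [DecidableEq α] (U : Finset α) (k : ℕ)
    (f : Finset α → ℝ) :
    ∑ i ∈ U, exchangeEnergyAt U k f i = exchangeEnergy U (k + 1) f := by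
  have h : ∀ i ∈ U, exchangeEnergyAt U k f i = ∑ A ∈ U.powersetCard (k + 1),
      if i ∈ A then ∑ j ∈ U \ A, logDirichlet (f A) (f (insert j (A.erase i))) else 0 := by
    intro i hi
    have key : ∀ m, ∀ A ∈ (U.erase i).powersetCard m, i ∉ A := fun m A hA hh =>
      Finset.notMem_erase i U ((Finset.mem_powersetCard.1 hA).1 hh)
    rw [sum_powersetCard_succ_erase hi, Finset.sum_eq_zero (s := (U.erase i).powersetCard (k + 1)),
      add_zero]
    · refine Finset.sum_congr rfl fun A hA => ?_
      have hset : U \ insert i A = U.erase i \ A := by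
        ext x; simp only [Finset.mem_sdiff, Finset.mem_insert, Finset.mem_erase]; tauto
      rw [if_pos (Finset.mem_insert_self i A), hset, Finset.erase_insert (key k A hA)]
    · intro A hA
      rw [if_neg (key _ A hA)]
  rw [Finset.sum_congr rfl h, Finset.sum_comm]
  refine Finset.sum_congr rfl fun A hA => ?_
  rw [← Finset.sum_filter]
  congr 1
  ext x
  simp only [Finset.mem_filter]
  exact ⟨fun h => h.2, fun h => ⟨(Finset.mem_powersetCard.1 hA).1 h, h⟩⟩

/-- Chain rule for the entropy, conditioning on `i ∈ A`. What remains is the entropy of the two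
conditional means `a` and `b`. It is bounded by `logDirichlet a b`, and the log-sum inequality
spreads this over the exchanges replacing `i` by some `j`. -/
theorem finsetEntropy_powersetCard_le {α : Type*} [DecidableEq α] {U : Finset α} {i : α}
    (hi : i ∈ U) {k : ℕ} (hk : k + 1 < U.card) {f : Finset α → ℝ} (hf : ∀ A, 0 < f A) :
    finsetEntropy (U.powersetCard (k + 1)) f ≤
      finsetEntropy ((U.erase i).powersetCard k) (fun A => f (insert i A)) +
        finsetEntropy ((U.erase i).powersetCard (k + 1)) f +
        exchangeEnergyAt U k f i / U.card := by
  obtain ⟨v, hv⟩ : ∃ v, (U.erase i).card = v := ⟨_, rfl⟩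
  have hUv : U.card = v + 1 := by rw [← hv, Finset.card_erase_add_one hi]
  have hkv : k + 1 ≤ v := by omega
  unfold finsetEntropy
  rw [sum_powersetCard_succ_erase hi, sum_powersetCard_succ_erase hi]
  simp only [Finset.card_powersetCard, hv, hUv]
  have hcard : ((v + 1).choose (k + 1) : ℝ) = v.choose k + v.choose (k + 1) := by
    rw [Nat.choose_succ_succ]; push_cast; rfl
  have hrel : (v.choose (k + 1) : ℝ) * (k + 1) = v.choose k * (v - k) := by
    have h := Nat.choose_succ_right_eq v k
    have h2 : ((v - k : ℕ) : ℝ) = v - k := Nat.cast_sub (by omega)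
    rw [← h2]
    exact_mod_cast h
  rw [hcard]
  have hZ1 : (0 : ℝ) < v.choose k := by exact_mod_cast Nat.choose_pos (by omega)
  have hZ0 : (0 : ℝ) < v.choose (k + 1) := by exact_mod_cast Nat.choose_pos hkv
  obtain ⟨a, ha⟩ : ∃ a, (∑ A ∈ (U.erase i).powersetCard k, f (insert i A)) / v.choose k = a :=
    ⟨_, rfl⟩
  obtain ⟨b, hb⟩ : ∃ b, (∑ A ∈ (U.erase i).powersetCard (k + 1), f A) / v.choose (k + 1) = b :=
    ⟨_, rfl⟩
  have ha0 : 0 < a := by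
    rw [← ha]
    refine div_pos (Finset.sum_pos (fun _ _ => hf _) ?_) hZ1
    exact Finset.powersetCard_nonempty.2 (by omega)
  have hb0 : 0 < b := by
    rw [← hb]
    refine div_pos (Finset.sum_pos (fun _ _ => hf _) ?_) hZ0
    exact Finset.powersetCard_nonempty.2 (by omega)
  rw [div_eq_iff hZ1.ne'] at ha
  rw [div_eq_iff hZ0.ne'] at hb
  -- The coefficient is the number of pairs `(A, j)`. Along these pairs `insert i A` covers each set
  -- containing `i` exactly `v - k` times, and `insert j A` each set avoiding `i` exactly `k + 1`
  -- times; `hrel` reconciles the two counts.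
  have hM : v.choose k * ((v : ℝ) - k) * logDirichlet a b ≤ exchangeEnergyAt U k f i := by
    unfold exchangeEnergyAt
    rw [Finset.sum_sigma']
    refine card_mul_logDirichlet_le_sum _ _ _ _ _ _ (fun _ _ => hf _) (fun _ _ => hf _)
      ha0 hb0 ?_ ?_
    · rw [Finset.sum_sigma (f := fun x : Σ _ : Finset α, α => f (insert i x.1))]
      have : ∀ A ∈ (U.erase i).powersetCard k, ∑ _j ∈ U.erase i \ A, f (insert i A) =
          ((v : ℝ) - k) * f (insert i A) := by
        intro A hA
        obtain ⟨hAU, hAk⟩ := Finset.mem_powersetCard.1 hA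
        rw [Finset.sum_const, nsmul_eq_mul, Finset.card_sdiff_of_subset hAU, hv, hAk,
          Nat.cast_sub (by omega)]
      rw [Finset.sum_congr rfl this, ← Finset.mul_sum, ha]
      ring
    · rw [Finset.sum_sigma (f := fun x : Σ _ : Finset α, α => f (insert x.2 x.1))]
      rw [sum_powersetCard_sum_insert, hb, ← hrel]
      ring
  rw [ha, hb, mul_div_cancel_right₀ a hZ1.ne', mul_div_cancel_right₀ b hZ0.ne']
  set Z1 : ℝ := (v.choose k : ℝ)
  set Z0 : ℝ := (v.choose (k + 1) : ℝ)
  have hZ : 0 < Z1 + Z0 := by positivity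
  have htwo := two_point_entropy_le (p := Z1 / (Z1 + Z0)) (q := Z0 / (Z1 + Z0))
    (by positivity) (by positivity) (by field_simp) ha0 hb0
  have hmean : Z1 / (Z1 + Z0) * a + Z0 / (Z1 + Z0) * b = (a * Z1 + b * Z0) / (Z1 + Z0) := by
    field_simp
  rw [hmean] at htwo
  have h3 := mul_le_mul_of_nonneg_left htwo hZ.le
  have hv1 : (0 : ℝ) < (v : ℝ) + 1 := by positivity
  have hcoef : (Z1 + Z0) * (Z1 / (Z1 + Z0) * (Z0 / (Z1 + Z0))) = Z1 * (v - k) / (v + 1) := by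
    field_simp
    linear_combination hrel
  have e1 : (Z1 + Z0) * (Z1 / (Z1 + Z0) * (Z0 / (Z1 + Z0)) * logDirichlet a b) =
      Z1 * (v - k) * logDirichlet a b / (v + 1) := by
    rw [← mul_assoc, hcoef]; ring
  have e2 : (Z1 + Z0) * (Z1 / (Z1 + Z0) * (a * Real.log a) + Z0 / (Z1 + Z0) * (b * Real.log b) -
      (a * Z1 + b * Z0) / (Z1 + Z0) * Real.log ((a * Z1 + b * Z0) / (Z1 + Z0))) =
      a * Z1 * Real.log a + b * Z0 * Real.log b -
        (a * Z1 + b * Z0) * Real.log ((a * Z1 + b * Z0) / (Z1 + Z0)) := by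
    generalize Real.log ((a * Z1 + b * Z0) / (Z1 + Z0)) = L
    field_simp
  rw [e1, e2] at h3
  have h4 := div_le_div_of_nonneg_right hM hv1.le
  push_cast
  linarith

theorem finsetEntropy_singleton {ι : Type*} (x : ι) (f : ι → ℝ) :
    finsetEntropy {x} f = 0 := by
  simp [finsetEntropy]

/-- The modified logarithmic Sobolev inequality for the Bernoulli–Laplace exchange process. -/
theorem finsetEntropy_le_exchangeEnergy {α : Type*} [DecidableEq α] (n : ℕ) :
    ∀ (U : Finset α), U.card = n → ∀ k ≤ n, ∀ f : Finset α → ℝ, (∀ A, 0 < f A) →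
      (n + 2 : ℝ) * finsetEntropy (U.powersetCard k) f ≤ exchangeEnergy U k f := by
  induction n with
  | zero =>
    intro U hU k hk f hf
    obtain rfl : k = 0 := by omega
    rw [Finset.powersetCard_zero, finsetEntropy_singleton, mul_zero]
    exact exchangeEnergy_nonneg U 0 hf
  | succ n ih =>
    intro U hU k hk f hf
    rcases k with _ | k
    · rw [Finset.powersetCard_zero, finsetEntropy_singleton, mul_zero]
      exact exchangeEnergy_nonneg U 0 hf
    rcases hk.eq_or_lt with hkn | hkn
    · rw [hkn, ← hU, Finset.powersetCard_self, finsetEntropy_singleton, mul_zero]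
      exact exchangeEnergy_nonneg U _ hf
    -- Slices consisting of one set are already excluded; the comparison of constants in `hcoef`
    -- needs this bound.
    have hn1 : (1 : ℝ) ≤ n := by
      have : 1 ≤ n := by omega
      exact_mod_cast this
    have hstep : ∀ i ∈ U, (n + 2 : ℝ) * finsetEntropy (U.powersetCard (k + 1)) f ≤
        (exchangeEnergy (U.erase i) k (fun A => f (insert i A)) +
          exchangeEnergy (U.erase i) (k + 1) f) +
        (n + 2) / (n + 1) * exchangeEnergyAt U k f i := by
      intro i hi
      have hcard : (U.erase i).card = n := by rw [Finset.card_erase_of_mem hi, hU]; rfl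
      have h1 := ih (U.erase i) hcard k (by omega) (fun A => f (insert i A)) fun A => hf _
      have h2 := ih (U.erase i) hcard (k + 1) (by omega) f hf
      have h3 := mul_le_mul_of_nonneg_left
        (finsetEntropy_powersetCard_le hi (k := k) (by omega) hf)
        (by positivity : (0 : ℝ) ≤ n + 2)
      rw [hU] at h3
      push_cast at h3
      have e : (n + 2 : ℝ) / (n + 1) * exchangeEnergyAt U k f i =
        (n + 2) * (exchangeEnergyAt U k f i / (n + 1)) := by ring
      rw [e]
      linarith
    -- Summing over all `i`, rather than fixing one, turns the right side into a multiple of the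
    -- full energy.
    have hsum := Finset.sum_le_sum hstep
    rw [Finset.sum_const, nsmul_eq_mul, hU, Finset.sum_add_distrib, sum_exchangeEnergy_erase,
      ← Finset.mul_sum, sum_exchangeEnergyAt, hU] at hsum
    push_cast at hsum ⊢
    have hE := exchangeEnergy_nonneg U (k + 1) hf
    set E := exchangeEnergy U (k + 1) f
    set T := finsetEntropy (U.powersetCard (k + 1)) f
    have hcoef : ((n : ℝ) + 1 - 2) + (n + 2) / (n + 1) ≤ (n + 1) * (n + 2) / (n + 3) := by
      rw [← sub_nonneg]
      have : ((n : ℝ) + 1) * (n + 2) / (n + 3) - (((n : ℝ) + 1 - 2) + (n + 2) / (n + 1)) =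
          (n - 1) / ((n + 1) * (n + 3)) := by
        field_simp
        ring
      rw [this]
      exact div_nonneg (by linarith) (by positivity)
    have h5 := mul_le_mul_of_nonneg_right hcoef hE
    have h6 : ((n : ℝ) + 1) * (n + 2) * T ≤ (n + 1) * (n + 2) * (E / (n + 3)) := by
      have e : ((n : ℝ) + 1) * (n + 2) / (n + 3) * E = (n + 1) * (n + 2) * (E / (n + 3)) := by ring
      rw [← e]
      linarith
    have h7 := le_of_mul_le_mul_left h6 (by positivity)
    rw [le_div_iff₀ (by positivity)] at h7
    linarith

/-! ### From entropy to exponential moments -/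

/-- The Herbst argument for the counting measure on a finite set. -/
theorem sum_exp_mul_sub_le_of_finsetEntropy_le {ι : Type*} (s : Finset ι) (hs : s.Nonempty)
    (g : ι → ℝ) (c : ℝ)
    (hent : ∀ r : ℝ, 0 < r → finsetEntropy s (fun x => Real.exp (r * g x)) ≤
      c * r ^ 2 * ∑ x ∈ s, Real.exp (r * g x)) {r : ℝ} (hr : 0 < r) :
    ∑ x ∈ s, Real.exp (r * (g x - (∑ y ∈ s, g y) / s.card)) ≤
      s.card * Real.exp (c * r ^ 2) := by
  have hZ : (0 : ℝ) < s.card := by exact_mod_cast hs.card_pos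
  let S : ℝ → ℝ := fun r => ∑ x ∈ s, Real.exp (r * g x)
  have hS : ∀ r, 0 < S r := fun r => Finset.sum_pos (fun _ _ => Real.exp_pos _) hs
  let S' : ℝ → ℝ := fun r => ∑ x ∈ s, Real.exp (r * g x) * g x
  have hSd : ∀ r, HasDerivAt S (S' r) r := by
    intro r
    refine HasDerivAt.fun_sum fun x _ => ?_
    simpa using ((hasDerivAt_id r).mul_const (g x)).exp
  let F : ℝ → ℝ := fun r => Real.log (S r / s.card)
  have hFd : ∀ r, HasDerivAt F (S' r / S r) r := by
    intro r
    have h := ((hSd r).div_const (s.card : ℝ)).log (div_pos (hS r) hZ).ne'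
    convert h using 1
    have := (hS r).ne'
    field_simp
  have hF0 : F 0 = 0 := by simp [F, S, hZ.ne']
  -- `F r / r` tends to the mean of `g` as `r` decreases to `0`, and the derivative of `F r / r` is
  -- the entropy divided by `r ^ 2 * S r`. The entropy hypothesis says exactly that `K` is
  -- nonincreasing, so `K r` is at most the mean.
  let K : ℝ → ℝ := fun r => F r / r - c * r
  have hKd : ∀ r, 0 < r → HasDerivAt K ((S' r / S r * r - F r * 1) / r ^ 2 - c * 1) r := by
    intro r hr
    exact ((hFd r).div (hasDerivAt_id r) hr.ne').sub ((hasDerivAt_id r).const_mul c)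
  have hKanti : AntitoneOn K (Set.Ioi 0) := by
    refine antitoneOn_of_deriv_nonpos (convex_Ioi 0)
      (fun r hr => (hKd r hr).continuousAt.continuousWithinAt) ?_ ?_
    · rw [interior_Ioi]
      exact fun r hr => (hKd r hr).differentiableAt.differentiableWithinAt
    · rw [interior_Ioi]
      intro r hr
      have hr' : 0 < r := hr
      rw [(hKd r hr).deriv]
      have h := hent r hr
      have e : finsetEntropy s (fun x => Real.exp (r * g x)) = r * S' r - S r * F r := by
        unfold finsetEntropy
        simp only [Real.log_exp]
        congr 1
        rw [Finset.mul_sum]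
        exact Finset.sum_congr rfl fun x _ => by ring
      rw [e] at h
      have hSr := hS r
      have h2 : r * S' r - S r * F r ≤ c * r ^ 2 * S r := h
      have h3 : S' r / S r * r - F r * 1 ≤ c * r ^ 2 := by
        have : S' r / S r * r - F r * 1 = (r * S' r - S r * F r) / S r := by
          field_simp
        rw [this, div_le_iff₀ hSr]
        exact h2
      have h4 := div_le_div_of_nonneg_right h3 (sq_nonneg r)
      have : c * r ^ 2 / r ^ 2 = c := by field_simp
      linarith
  have hlim : Filter.Tendsto K (nhdsWithin 0 (Set.Ioi 0))
      (nhds ((∑ y ∈ s, g y) / s.card)) := by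
    have h0 : HasDerivAt F ((∑ y ∈ s, g y) / s.card) 0 := by
      convert hFd 0 using 1
      simp [S, S']
    have h1 := (hasDerivAt_iff_tendsto_slope_zero.1 h0).mono_left
      (nhdsWithin_mono 0 (fun x (hx : 0 < x) => hx.ne') : nhdsWithin (0 : ℝ) (Set.Ioi 0) ≤ _)
    have h2 : Filter.Tendsto (fun r : ℝ => c * r) (nhdsWithin 0 (Set.Ioi 0)) (nhds (c * 0)) :=
      ((continuous_const.mul continuous_id).tendsto 0).mono_left nhdsWithin_le_nhds
    have h3 := h1.sub h2
    rw [mul_zero, sub_zero] at h3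
    refine h3.congr fun r => ?_
    simp only [zero_add, hF0, sub_zero, smul_eq_mul, K]
    ring
  have hK : K r ≤ (∑ y ∈ s, g y) / s.card := by
    refine ge_of_tendsto hlim ?_
    filter_upwards [Ioo_mem_nhdsGT hr] with x hx
    exact hKanti hx.1 hr hx.2.le
  set M := (∑ y ∈ s, g y) / s.card
  have hF : F r ≤ r * M + c * r ^ 2 := by
    have : F r / r ≤ M + c * r := by simp only [K] at hK; linarith
    rw [div_le_iff₀ hr] at this
    linarith
  have hle : S r / s.card ≤ Real.exp (r * M + c * r ^ 2) :=
    (Real.log_le_iff_le_exp (div_pos (hS r) hZ)).1 hF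
  rw [div_le_iff₀ hZ] at hle
  have e : ∑ x ∈ s, Real.exp (r * (g x - M)) = S r * Real.exp (-(r * M)) := by
    rw [Finset.sum_mul]
    refine Finset.sum_congr rfl fun x _ => ?_
    rw [← Real.exp_add]
    congr 1
    ring
  rw [e]
  calc S r * Real.exp (-(r * M)) ≤
      Real.exp (r * M + c * r ^ 2) * s.card * Real.exp (-(r * M)) := by gcongr
    _ = s.card * Real.exp (c * r ^ 2) := by
      rw [mul_right_comm, ← Real.exp_add, mul_comm]
      congr 2
      ring

/-! ### Concentration on the slice -/

/-- Reversibility: undoing an exchange is again an exchange, so `(A, i, j) ↦ (insert j (A.erase i),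
j, i)` is an involution. -/
theorem sum_exchange_comm {α : Type*} [DecidableEq α] (U : Finset α) (k : ℕ)
    (G : Finset α → Finset α → ℝ) :
    ∑ A ∈ U.powersetCard k, ∑ i ∈ A, ∑ j ∈ U \ A, G A (insert j (A.erase i)) =
      ∑ A ∈ U.powersetCard k, ∑ i ∈ A, ∑ j ∈ U \ A, G (insert j (A.erase i)) A := by
  simp only [← Finset.sum_product']
  rw [Finset.sum_sigma', Finset.sum_sigma']
  have hmem : ∀ x ∈ (U.powersetCard k).sigma (fun A => A ×ˢ (U \ A)),
      (⟨insert x.2.2 (x.1.erase x.2.1), (x.2.2, x.2.1)⟩ : Σ _ : Finset α, α × α) ∈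
        (U.powersetCard k).sigma (fun A => A ×ˢ (U \ A)) := by
    rintro ⟨A, i, j⟩ hx
    simp only [Finset.mem_sigma, Finset.mem_powersetCard, Finset.mem_product,
      Finset.mem_sdiff] at hx ⊢
    obtain ⟨⟨hA, hc⟩, hi, hj, hjA⟩ := hx
    have hjA' : j ∉ A.erase i := fun h => hjA (Finset.mem_of_mem_erase h)
    have hij : i ≠ j := fun h => hjA (h ▸ hi)
    refine ⟨⟨Finset.insert_subset hj ((Finset.erase_subset _ _).trans hA), ?_⟩,
      Finset.mem_insert_self _ _, hA hi, ?_⟩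
    · rw [Finset.card_insert_of_notMem hjA', Finset.card_erase_add_one hi, hc]
    · simp [hij]
  have hinv : ∀ x ∈ (U.powersetCard k).sigma (fun A => A ×ˢ (U \ A)),
      insert x.2.1 ((insert x.2.2 (x.1.erase x.2.1)).erase x.2.2) = x.1 := by
    rintro ⟨A, i, j⟩ hx
    simp only [Finset.mem_sigma, Finset.mem_product, Finset.mem_sdiff] at hx ⊢
    obtain ⟨-, hi, -, hjA⟩ := hx
    have hjA' : j ∉ A.erase i := fun h => hjA (Finset.mem_of_mem_erase h)
    rw [Finset.erase_insert hjA', Finset.insert_erase hi]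
  refine Finset.sum_bij' (fun x _ => ⟨insert x.2.2 (x.1.erase x.2.1), (x.2.2, x.2.1)⟩)
    (fun x _ => ⟨insert x.2.2 (x.1.erase x.2.1), (x.2.2, x.2.1)⟩) hmem hmem ?_ ?_ ?_
  · intro x hx
    simp only [hinv x hx]
  · intro x hx
    simp only [hinv x hx]
  · intro x hx
    simp only [hinv x hx]

/-- From `1 - exp (y - x) ≤ x - y` for `y ≤ x`. Putting the weight at the larger endpoint means that
only decreases of the exponent away from the weighted point count. -/
theorem logDirichlet_exp_le (x y : ℝ) :
    logDirichlet (Real.exp x) (Real.exp y) ≤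
      max (x - y) 0 ^ 2 * Real.exp x + max (y - x) 0 ^ 2 * Real.exp y := by
  have key : ∀ x y : ℝ, y ≤ x → (Real.exp x - Real.exp y) * (x - y) ≤ (x - y) ^ 2 * Real.exp x := by
    intro x y h
    have h1 := Real.add_one_le_exp (y - x)
    rw [Real.exp_sub, le_div_iff₀ (Real.exp_pos x)] at h1
    nlinarith
  unfold logDirichlet
  rw [Real.log_exp, Real.log_exp]
  rcases le_total y x with h | h
  · rw [max_eq_left (by linarith), max_eq_right (by linarith)]
    linarith [key x y h]
  · rw [max_eq_right (by linarith), max_eq_left (by linarith)]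
    linarith [key y x h]

/-- The sum over all exchanges of the squared decreases of `g` from the subset `A` of `U`. -/
noncomputable def exchangeVariation {α : Type*} [DecidableEq α] (U : Finset α)
    (g : Finset α → ℝ) (A : Finset α) : ℝ :=
  ∑ i ∈ A, ∑ j ∈ U \ A, max (g A - g (insert j (A.erase i))) 0 ^ 2

/-- The two terms of `logDirichlet_exp_le` have equal sums by reversibility, whence the factor 2. -/
theorem exchangeEnergy_exp_le {α : Type*} [DecidableEq α] (U : Finset α) (k : ℕ)
    (g : Finset α → ℝ) (V : ℝ) (hV : ∀ A ∈ U.powersetCard k, exchangeVariation U g A ≤ V)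
    {r : ℝ} (hr : 0 < r) :
    exchangeEnergy U k (fun A => Real.exp (r * g A)) ≤
      2 * V * r ^ 2 * ∑ A ∈ U.powersetCard k, Real.exp (r * g A) := by
  have hmax : ∀ x y : ℝ, max (r * x - r * y) 0 = r * max (x - y) 0 := by
    intro x y
    rw [mul_max_of_nonneg _ _ hr.le, mul_zero, mul_sub]
  have h1 : exchangeEnergy U k (fun A => Real.exp (r * g A)) ≤
      ∑ A ∈ U.powersetCard k, ∑ i ∈ A, ∑ j ∈ U \ A,
        (max (r * g A - r * g (insert j (A.erase i))) 0 ^ 2 * Real.exp (r * g A) +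
          max (r * g (insert j (A.erase i)) - r * g A) 0 ^ 2 *
            Real.exp (r * g (insert j (A.erase i)))) :=
    Finset.sum_le_sum fun _ _ => Finset.sum_le_sum fun _ _ => Finset.sum_le_sum fun _ _ =>
      logDirichlet_exp_le _ _
  simp only [Finset.sum_add_distrib] at h1
  rw [sum_exchange_comm U k
    (fun A B => max (r * g B - r * g A) 0 ^ 2 * Real.exp (r * g B)), ← two_mul] at h1
  refine h1.trans ?_
  have h2 : ∑ A ∈ U.powersetCard k, ∑ i ∈ A, ∑ j ∈ U \ A,
      max (r * g A - r * g (insert j (A.erase i))) 0 ^ 2 * Real.exp (r * g A) ≤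
      ∑ A ∈ U.powersetCard k, V * r ^ 2 * Real.exp (r * g A) := by
    refine Finset.sum_le_sum fun A hA => ?_
    have : ∑ i ∈ A, ∑ j ∈ U \ A,
        max (r * g A - r * g (insert j (A.erase i))) 0 ^ 2 * Real.exp (r * g A) =
        exchangeVariation U g A * (r ^ 2 * Real.exp (r * g A)) := by
      unfold exchangeVariation
      simp only [Finset.sum_mul, hmax]
      exact Finset.sum_congr rfl fun _ _ => Finset.sum_congr rfl fun _ _ => by ring
    rw [this, mul_assoc V]
    exact mul_le_mul_of_nonneg_right (hV A hA) (by positivity)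
  rw [← Finset.mul_sum] at h2
  linarith

theorem sum_exp_powersetCard_le {α : Type*} [DecidableEq α] (U : Finset α) {k : ℕ}
    (hk : k ≤ U.card) (g : Finset α → ℝ) (V : ℝ)
    (hV : ∀ A ∈ U.powersetCard k, exchangeVariation U g A ≤ V) {r : ℝ} (hr : 0 < r) :
    ∑ A ∈ U.powersetCard k,
        Real.exp (r * (g A - (∑ B ∈ U.powersetCard k, g B) / (U.powersetCard k).card)) ≤
      (U.powersetCard k).card * Real.exp (2 * V / (U.card + 2) * r ^ 2) := by
  refine sum_exp_mul_sub_le_of_finsetEntropy_le _ (Finset.powersetCard_nonempty.2 hk) g _ ?_ hr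
  intro r hr
  have h1 := finsetEntropy_le_exchangeEnergy U.card U rfl k hk
    (fun A => Real.exp (r * g A)) fun _ => Real.exp_pos _
  have h2 := h1.trans (exchangeEnergy_exp_le U k g V hV hr)
  have h3 : finsetEntropy (U.powersetCard k) (fun A => Real.exp (r * g A)) ≤
      (2 * V * r ^ 2 * ∑ A ∈ U.powersetCard k, Real.exp (r * g A)) / (U.card + 2) := by
    rw [le_div_iff₀ (by positivity)]
    linarith
  refine h3.trans (le_of_eq ?_)
  ring

/-- Concentration on the slice: one-sided deviations of a function with bounded exchange
variation. -/
theorem card_filter_lt_le {α : Type*} [DecidableEq α] (U : Finset α) {k : ℕ}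
    (hk : k ≤ U.card) (g : Finset α → ℝ) {V : ℝ} (hV0 : 0 < V)
    (hV : ∀ A ∈ U.powersetCard k, exchangeVariation U g A ≤ V) {ε : ℝ} (hε : 0 < ε) :
    (((U.powersetCard k).filter fun A =>
        (∑ B ∈ U.powersetCard k, g B) / (U.powersetCard k).card + ε < g A).card : ℝ) ≤
      (U.powersetCard k).card * Real.exp (-((U.card + 2) * ε ^ 2 / (8 * V))) := by
  set M := (∑ B ∈ U.powersetCard k, g B) / (U.powersetCard k).card with hM
  set c := 2 * V / ((U.card : ℝ) + 2) with hc
  have hc0 : 0 < c := by positivity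
  -- The value of `r` minimising `c * r ^ 2 - r * ε`; the minimum is `-(ε ^ 2 / (4 * c))`.
  have hr : 0 < ε / (2 * c) := by positivity
  have h1 := sum_exp_powersetCard_le U hk g V hV hr
  rw [← hM, ← hc] at h1
  have h2 : ∑ _A ∈ (U.powersetCard k).filter (fun A => M + ε < g A),
      Real.exp (ε / (2 * c) * ε) ≤
      ∑ A ∈ U.powersetCard k, Real.exp (ε / (2 * c) * (g A - M)) := by
    refine (Finset.sum_le_sum fun A hA => ?_).trans
      (Finset.sum_le_sum_of_subset_of_nonneg (Finset.filter_subset _ _)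
        fun _ _ _ => (Real.exp_pos _).le)
    have := (Finset.mem_filter.1 hA).2
    exact Real.exp_le_exp.2 (mul_le_mul_of_nonneg_left (by linarith) hr.le)
  rw [Finset.sum_const, nsmul_eq_mul] at h2
  have h3 := h2.trans h1
  rw [← le_div_iff₀ (Real.exp_pos _), mul_div_assoc, ← Real.exp_sub] at h3
  refine h3.trans (le_of_eq ?_)
  congr 2
  rw [hc]
  field_simp
  ring

/-- The degenerate case `V = 0`: the mean of `exp (g - M)` is at most 1, whereas `exp x ≥ 1 + x`,
strictly for `x ≠ 0`, makes it larger than 1 if `g` exceeds its mean somewhere. -/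
theorem le_average_of_exchangeVariation_nonpos {α : Type*} [DecidableEq α] (U : Finset α) {k : ℕ}
    (hk : k ≤ U.card) (g : Finset α → ℝ)
    (hV : ∀ A ∈ U.powersetCard k, exchangeVariation U g A ≤ 0) :
    ∀ A ∈ U.powersetCard k,
      g A ≤ (∑ B ∈ U.powersetCard k, g B) / (U.powersetCard k).card := by
  intro A hA
  have hZ : (0 : ℝ) < (U.powersetCard k).card := by
    exact_mod_cast (Finset.powersetCard_nonempty.2 hk).card_pos
  have h1 := sum_exp_powersetCard_le U hk g 0 hV one_pos
  set M := (∑ B ∈ U.powersetCard k, g B) / (U.powersetCard k).card with hM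
  by_contra! hlt
  have h2 : ∑ B ∈ U.powersetCard k, (g B - M + 1) <
      ∑ B ∈ U.powersetCard k, Real.exp (1 * (g B - M)) := by
    refine Finset.sum_lt_sum (fun B _ => ?_) ⟨A, hA, ?_⟩
    · rw [one_mul]; exact Real.add_one_le_exp _
    · rw [one_mul]; exact Real.add_one_lt_exp (by linarith)
  have h3 : ∑ B ∈ U.powersetCard k, (g B - M + 1) = (U.powersetCard k).card := by
    rw [Finset.sum_add_distrib, Finset.sum_sub_distrib, Finset.sum_const, Finset.sum_const, hM]
    simp only [nsmul_eq_mul, mul_one]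
    field_simp
    ring
  rw [h3] at h2
  simp at h1
  simp at h2
  linarith

/-! ### Variance bound for the exchange variation of the maximal deviation -/

/-- Sum of squared differences across a cut. -/
theorem sum_cut_sq_sub_le {α : Type*} [DecidableEq α] {U A : Finset α} (hA : A ⊆ U)
    (y : α → ℝ) (c : ℝ) :
    ∑ i ∈ A, ∑ j ∈ U \ A, (y j - y i) ^ 2 ≤ U.card * ∑ x ∈ U, (y x - c) ^ 2 := by
  -- The sum over all ordered pairs contains the cut twice, once in each direction, which cancels
  -- the factor 2 here; the last square is discarded.
  have hfull : ∑ i ∈ U, ∑ j ∈ U, (y j - y i) ^ 2 =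
      2 * (U.card * ∑ x ∈ U, (y x - c) ^ 2) - 2 * (∑ x ∈ U, (y x - c)) ^ 2 := by
    have h1 : ∀ i j, (y j - y i) ^ 2 =
        (y j - c) ^ 2 + (y i - c) ^ 2 - 2 * ((y i - c) * (y j - c)) := fun i j => by ring
    simp only [h1, Finset.sum_add_distrib, Finset.sum_sub_distrib, Finset.sum_const,
      ← Finset.mul_sum, ← Finset.sum_mul, nsmul_eq_mul]
    ring
  have hsplit : ∀ F : α → ℝ, ∑ x ∈ U, F x = ∑ x ∈ A, F x + ∑ x ∈ U \ A, F x := fun F => by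
    rw [add_comm, Finset.sum_sdiff hA]
  have h2 : ∑ i ∈ A, ∑ j ∈ U \ A, (y j - y i) ^ 2 + ∑ i ∈ U \ A, ∑ j ∈ A, (y j - y i) ^ 2 ≤
      ∑ i ∈ U, ∑ j ∈ U, (y j - y i) ^ 2 := by
    rw [hsplit]
    refine add_le_add (Finset.sum_le_sum fun i _ => ?_) (Finset.sum_le_sum fun i _ => ?_)
    · rw [hsplit]
      exact le_add_of_nonneg_left (Finset.sum_nonneg fun _ _ => sq_nonneg _)
    · rw [hsplit fun j => (y j - y i) ^ 2]
      exact le_add_of_nonneg_right (Finset.sum_nonneg fun _ _ => sq_nonneg _)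
  have h3 : ∑ i ∈ U \ A, ∑ j ∈ A, (y j - y i) ^ 2 = ∑ i ∈ A, ∑ j ∈ U \ A, (y j - y i) ^ 2 := by
    rw [Finset.sum_comm]
    exact Finset.sum_congr rfl fun _ _ => Finset.sum_congr rfl fun _ _ => by ring
  rw [h3, hfull] at h2
  nlinarith [sq_nonneg (∑ x ∈ U, (y x - c))]

section Loss

variable {X Y : Type*} {ℓ : Y → Y → ℝ}

theorem pointLoss_mem_Icc (hℓ : ∀ y y' : Y, ℓ y y' ∈ Set.Icc (0 : ℝ) 1) (φ h : X → Y) (x : X) :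
    pointLoss ℓ φ h x ∈ Set.Icc (0 : ℝ) 1 := hℓ _ _

theorem averageLoss_mem_Icc (hℓ : ∀ y y' : Y, ℓ y y' ∈ Set.Icc (0 : ℝ) 1) (φ : X → Y)
    (S : Finset X) (h : X → Y) : averageLoss ℓ φ S h ∈ Set.Icc (0 : ℝ) 1 := by
  unfold averageLoss
  constructor
  · exact mul_nonneg (by positivity) (Finset.sum_nonneg fun x _ => (pointLoss_mem_Icc hℓ φ h x).1)
  · rw [one_div, inv_mul_eq_div]
    refine div_le_one_of_le₀ ?_ (Nat.cast_nonneg _)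
    calc ∑ x ∈ S, pointLoss ℓ φ h x ≤ ∑ _x ∈ S, (1 : ℝ) :=
          Finset.sum_le_sum fun x _ => (pointLoss_mem_Icc hℓ φ h x).2
      _ = S.card := by simp

/-- Needed because a real `⨆` over an unbounded family is 0 by convention and would bound nothing.
-/
theorem bddAbove_range_deviation (hℓ : ∀ y y' : Y, ℓ y y' ∈ Set.Icc (0 : ℝ) 1) (φ : X → Y)
    (H : Set (X → Y)) (XN S : Finset X) :
    BddAbove (Set.range fun h : H => averageLoss ℓ φ XN h - averageLoss ℓ φ S h) := by
  refine ⟨1, ?_⟩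
  rintro _ ⟨h, rfl⟩
  have h1 := (averageLoss_mem_Icc hℓ φ XN h).2
  have h2 := (averageLoss_mem_Icc hℓ φ S h).1
  dsimp only
  linarith

theorem bddAbove_range_variance (hℓ : ∀ y y' : Y, ℓ y y' ∈ Set.Icc (0 : ℝ) 1) (φ : X → Y)
    (H : Set (X → Y)) (XN : Finset X) :
    BddAbove (Set.range fun h : H =>
      (1 / (XN.card : ℝ)) * ∑ x ∈ XN, (pointLoss ℓ φ h x - averageLoss ℓ φ XN h) ^ 2) := by
  refine ⟨1, ?_⟩
  rintro _ ⟨h, rfl⟩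
  dsimp only
  rw [one_div, inv_mul_eq_div]
  refine div_le_one_of_le₀ ?_ (Nat.cast_nonneg _)
  calc ∑ x ∈ XN, (pointLoss ℓ φ h x - averageLoss ℓ φ XN h) ^ 2 ≤ ∑ _x ∈ XN, (1 : ℝ) := by
        refine Finset.sum_le_sum fun x _ => ?_
        have h1 := pointLoss_mem_Icc hℓ φ h x
        have h2 := averageLoss_mem_Icc hℓ φ XN h
        rw [sq_le_one_iff_abs_le_one, abs_le]
        constructor <;> linarith [h1.1, h1.2, h2.1, h2.2]
    _ = XN.card := by simp

theorem supVariance_nonneg (ℓ : Y → Y → ℝ) (φ : X → Y) (H : Set (X → Y)) (XN : Finset X) :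
    0 ≤ supVariance ℓ φ H XN :=
  Real.iSup_nonneg fun _ => mul_nonneg (by positivity) (Finset.sum_nonneg fun _ _ => sq_nonneg _)

theorem averageLoss_exchange_sub [DecidableEq X] (ℓ : Y → Y → ℝ) (φ h : X → Y) {A : Finset X}
    {i j : X} (hi : i ∈ A) (hj : j ∉ A) :
    averageLoss ℓ φ (insert j (A.erase i)) h - averageLoss ℓ φ A h =
      (1 / (A.card : ℝ)) * (pointLoss ℓ φ h j - pointLoss ℓ φ h i) := by
  have hj' : j ∉ A.erase i := fun hh => hj (Finset.mem_of_mem_erase hh)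
  unfold averageLoss
  rw [Finset.card_insert_of_notMem hj', Finset.card_erase_add_one hi, Finset.sum_insert hj',
    ← Finset.add_sum_erase A _ hi]
  ring

/-- The exchange variation of the maximal deviation is controlled by the maximal variance. -/
theorem exchangeVariation_supDeviation_le [DecidableEq X]
    (hℓ : ∀ y y' : Y, ℓ y y' ∈ Set.Icc (0 : ℝ) 1) (φ : X → Y) {H : Set (X → Y)}
    (hH : H.Nonempty) {XN A : Finset X} (hA : A ⊆ XN) :
    exchangeVariation XN (supDeviation ℓ φ H XN) A ≤
      (XN.card : ℝ) ^ 2 / (A.card : ℝ) ^ 2 * supVariance ℓ φ H XN := by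
  have : Nonempty H := hH.to_subtype
  set g := supDeviation ℓ φ H XN with hg
  -- The supremum need not be attained, so the bound is shown with slack `δ`, and `δ` then tends to
  -- 0 by continuity.
  have hδ : ∀ δ : ℝ, 0 < δ →
      ∑ i ∈ A, ∑ j ∈ XN \ A, max (g A - g (insert j (A.erase i)) - δ) 0 ^ 2 ≤
        (XN.card : ℝ) ^ 2 / (A.card : ℝ) ^ 2 * supVariance ℓ φ H XN := by
    intro δ hδ
    -- This `h` depends on `A` and `δ` only, not on `i` and `j`; hence the whole double sum is
    -- governed by the variance of a single hypothesis.
    obtain ⟨h, hh⟩ : ∃ h : H, g A - δ < averageLoss ℓ φ XN h - averageLoss ℓ φ A h :=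
      exists_lt_of_lt_ciSup (sub_lt_self (g A) hδ)
    calc ∑ i ∈ A, ∑ j ∈ XN \ A, max (g A - g (insert j (A.erase i)) - δ) 0 ^ 2
        ≤ ∑ i ∈ A, ∑ j ∈ XN \ A,
          1 / (A.card : ℝ) ^ 2 * (pointLoss ℓ φ h j - pointLoss ℓ φ h i) ^ 2 := by
          refine Finset.sum_le_sum fun i hi => Finset.sum_le_sum fun j hj => ?_
          have h1 : averageLoss ℓ φ XN h - averageLoss ℓ φ (insert j (A.erase i)) h ≤
              g (insert j (A.erase i)) :=
            le_ciSup (bddAbove_range_deviation hℓ φ H XN (insert j (A.erase i))) h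
          have h2 := averageLoss_exchange_sub ℓ φ h hi (Finset.mem_sdiff.1 hj).2
          have h3 : max (g A - g (insert j (A.erase i)) - δ) 0 ≤
              |1 / (A.card : ℝ) * (pointLoss ℓ φ h j - pointLoss ℓ φ h i)| := by
            refine max_le ?_ (abs_nonneg _)
            rw [← h2]
            exact le_trans (by linarith) (le_abs_self _)
          have h4 := pow_le_pow_left₀ (le_max_right _ _) h3 2
          rw [sq_abs, mul_pow, div_pow, one_pow] at h4
          exact h4
      _ = 1 / (A.card : ℝ) ^ 2 *
          ∑ i ∈ A, ∑ j ∈ XN \ A, (pointLoss ℓ φ h j - pointLoss ℓ φ h i) ^ 2 := by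
          simp only [Finset.mul_sum]
      _ ≤ 1 / (A.card : ℝ) ^ 2 * (XN.card *
          ∑ x ∈ XN, (pointLoss ℓ φ h x - averageLoss ℓ φ XN h) ^ 2) := by
          gcongr
          exact sum_cut_sq_sub_le hA _ _
      _ ≤ 1 / (A.card : ℝ) ^ 2 * (XN.card * (XN.card * supVariance ℓ φ H XN)) := by
          gcongr
          have h1 := le_ciSup (bddAbove_range_variance hℓ φ H XN) h
          rcases XN.eq_empty_or_nonempty with rfl | hne
          · simp
          · have hc : (0 : ℝ) < XN.card := by exact_mod_cast hne.card_pos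
            have h2 := mul_le_mul_of_nonneg_left h1 hc.le
            rw [← mul_assoc, mul_one_div_cancel hc.ne', one_mul] at h2
            exact h2
      _ = (XN.card : ℝ) ^ 2 / (A.card : ℝ) ^ 2 * supVariance ℓ φ H XN := by ring
  have hcont : Continuous fun δ : ℝ =>
      ∑ i ∈ A, ∑ j ∈ XN \ A, max (g A - g (insert j (A.erase i)) - δ) 0 ^ 2 := by
    fun_prop
  have hlim := (hcont.tendsto 0).mono_left (nhdsWithin_le_nhds (s := Set.Ioi 0))
  simp only [sub_zero] at hlim
  refine le_of_tendsto hlim ?_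
  filter_upwards [self_mem_nhdsWithin] with δ hpos
  exact hδ δ hpos

end Loss

/-! ### Uniform samples and counting -/

section Sampling

variable {Ω X : Type*} [MeasurableSpace Ω] {μ : Measure Ω}
  {XN : Finset X} {m : ℕ} {Xm : Ω → Finset X}

theorem IsUniformSample.measureReal_mem [IsProbabilityMeasure μ]
    (hXm : IsUniformSample μ XN m Xm)
    {B : Finset (Finset X)} (hB : B ⊆ XN.powersetCard m) :
    μ.real {ω | Xm ω ∈ B} = B.card / (XN.card.choose m : ℝ) := by
  have h : {ω | Xm ω ∈ B} = ⋃ A ∈ B, {ω | Xm ω = A} := by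
    ext ω
    simp
  rw [h, measureReal_biUnion_finset]
  · rw [Finset.sum_congr rfl fun A hA => (hXm A (hB hA)).2, Finset.sum_const, nsmul_eq_mul,
      mul_one_div]
  · intro A _ A' _ hAA'
    rw [Function.onFun, Set.disjoint_left]
    intro ω h1 h2
    exact hAA' (h1.symm.trans h2)
  · exact fun A hA => (hXm A (hB hA)).1

theorem IsUniformSample.measurableSet_mem (hXm : IsUniformSample μ XN m Xm)
    {B : Finset (Finset X)} (hB : B ⊆ XN.powersetCard m) : MeasurableSet {ω | Xm ω ∈ B} := by
  have h : {ω | Xm ω ∈ B} = ⋃ A ∈ B, {ω | Xm ω = A} := by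
    ext ω
    simp
  rw [h]
  exact Finset.measurableSet_biUnion _ fun A hA => (hXm A (hB hA)).1

theorem IsUniformSample.ae_mem [IsProbabilityMeasure μ]
    (hXm : IsUniformSample μ XN m Xm) (hm : m ≤ XN.card) :
    ∀ᵐ ω ∂μ, Xm ω ∈ XN.powersetCard m := by
  have h1 := hXm.measureReal_mem (Finset.Subset.refl _)
  have hZ : (0 : ℝ) < XN.card.choose m := by exact_mod_cast Nat.choose_pos hm
  rw [Finset.card_powersetCard, div_self hZ.ne'] at h1
  change {ω | Xm ω ∈ XN.powersetCard m} ∈ ae μ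
  rw [mem_ae_iff_prob_eq_one (hXm.measurableSet_mem (Finset.Subset.refl _)),
    ← ofReal_measureReal, h1, ENNReal.ofReal_one]

theorem IsUniformSample.integral_comp [IsProbabilityMeasure μ]
    (hXm : IsUniformSample μ XN m Xm) (hm : m ≤ XN.card)
    (g : Finset X → ℝ) :
    ∫ ω, g (Xm ω) ∂μ =
      (∑ A ∈ XN.powersetCard m, g A) / (XN.powersetCard m).card := by
  classical
  -- Only the events `Xm ω = A` with `A` in the slice are known to be measurable, so the integrand
  -- is replaced almost everywhere by a finite sum of indicators.
  have h1 : (fun ω => g (Xm ω)) =ᵐ[μ] fun ω => ∑ A ∈ XN.powersetCard m,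
      {ω | Xm ω = A}.indicator (fun _ => g A) ω := by
    filter_upwards [hXm.ae_mem hm] with ω hω
    rw [Finset.sum_eq_single_of_mem (Xm ω) hω]
    · simp
    · intro A _ hA
      exact Set.indicator_of_notMem (fun h : Xm ω = A => hA h.symm) _
  rw [integral_congr_ae h1, integral_finsetSum, Finset.sum_div]
  · refine Finset.sum_congr rfl fun A hA => ?_
    rw [integral_indicator_const _ (hXm A hA).1, (hXm A hA).2, Finset.card_powersetCard,
      smul_eq_mul]
    ring
  · exact fun A hA => (integrable_const _).indicator (hXm A hA).1

end Sampling

/-! ### The concentration inequality -/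

theorem mainTheorem8 {X Y Ω : Type*} [MeasurableSpace Ω] (μ : Measure Ω) [IsProbabilityMeasure μ]
    (ℓ : Y → Y → ℝ) (hℓ : ∀ y y' : Y, ℓ y y' ∈ Set.Icc (0 : ℝ) 1)
    (φ : X → Y) (H : Set (X → Y))
    (N m : ℕ) (hm : 0 < m) (hmN : m ≤ N)
    (XN : Finset X) (hN : XN.card = N)
    (Xm : Ω → Finset X) (hXm : IsUniformSample μ XN m Xm)
    (t : ℝ) (ht : 0 ≤ t) :
    1 - Real.exp (-t) <
      μ.real {ω | ∀ h ∈ H,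
        averageLoss ℓ φ XN h - averageLoss ℓ φ (Xm ω) h ≤
          (∫ ω', supDeviation ℓ φ H XN (Xm ω') ∂μ) +
            2 * Real.sqrt (2 * ((N : ℝ) / (m : ℝ) ^ 2) * supVariance ℓ φ H XN * t)} := by
  classical
  subst hN
  rcases H.eq_empty_or_nonempty with rfl | hH
  -- With no hypotheses the event is the whole space.
  · simp [Real.exp_pos]
  rw [hXm.integral_comp hmN]
  set g := supDeviation ℓ φ H XN with hg
  set P := XN.powersetCard m with hP
  set M := (∑ A ∈ P, g A) / P.card with hM
  set σ2 := supVariance ℓ φ H XN with hσ2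
  set ε := 2 * Real.sqrt (2 * ((XN.card : ℝ) / (m : ℝ) ^ 2) * σ2 * t) with hε
  have hPne : P.Nonempty := Finset.powersetCard_nonempty.2 hmN
  have hZ : (0 : ℝ) < P.card := by exact_mod_cast hPne.card_pos
  have hm0 : (0 : ℝ) < m := by exact_mod_cast hm
  have hN0 : (0 : ℝ) < XN.card := by exact_mod_cast hm.trans_le hmN
  have hσ0 : 0 ≤ σ2 := supVariance_nonneg ℓ φ H XN
  have hε0 : 0 ≤ ε := by positivity
  have hV : ∀ A ∈ P, exchangeVariation XN g A ≤ (XN.card : ℝ) ^ 2 / (m : ℝ) ^ 2 * σ2 := by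
    intro A hA
    obtain ⟨h1, h2⟩ := Finset.mem_powersetCard.1 hA
    have h3 := exchangeVariation_supDeviation_le hℓ φ hH h1
    rwa [h2] at h3
  -- The tail bound needs `V > 0` and `ε > 0`, so `σ2 = 0` and `t = 0` are treated apart: in the
  -- first case no subset is bad, in the second some subset does not exceed the mean.
  have hbad : ((P.filter fun A => M + ε < g A).card : ℝ) < P.card * Real.exp (-t) := by
    rcases hσ0.eq_or_lt with hσ | hσ
    · rw [← hσ, mul_zero] at hV
      rw [Finset.filter_eq_empty_iff.2, Finset.card_empty, Nat.cast_zero]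
      · positivity
      · intro A hA
        have := le_average_of_exchangeVariation_nonpos XN hmN g hV A hA
        rw [not_lt]
        linarith
    rcases ht.eq_or_lt with ht0 | ht0
    · rw [← ht0, neg_zero, Real.exp_zero, mul_one]
      have : ε = 0 := by rw [hε, ← ht0]; simp
      obtain ⟨A, hA, hAg⟩ : ∃ A ∈ P, g A ≤ M := by
        refine Finset.exists_le_of_sum_le hPne ?_
        rw [Finset.sum_const, nsmul_eq_mul, hM, mul_div_cancel₀ _ hZ.ne']
      exact_mod_cast Finset.card_lt_card (Finset.filter_ssubset.2 ⟨A, hA, by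
        rw [this, add_zero, not_lt]; exact hAg⟩)
    · have hεpos : 0 < ε := by positivity
      refine (card_filter_lt_le XN hmN g (by positivity) hV hεpos).trans_lt ?_
      refine mul_lt_mul_of_pos_left (Real.exp_lt_exp.2 (neg_lt_neg ?_)) hZ
      have h1 : ε ^ 2 = 4 * (2 * ((XN.card : ℝ) / (m : ℝ) ^ 2) * σ2 * t) := by
        rw [hε, mul_pow, Real.sq_sqrt (by positivity)]
        norm_num
      -- The `+ 2` in the Sobolev constant leaves a positive surplus over `t`, which gives the
      -- strict inequality.
      rw [h1, lt_div_iff₀ (by positivity), ← sub_pos]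
      have : ((XN.card : ℝ) + 2) * (4 * (2 * (XN.card / (m : ℝ) ^ 2) * σ2 * t)) -
          t * (8 * ((XN.card : ℝ) ^ 2 / (m : ℝ) ^ 2 * σ2)) =
          16 * (XN.card / (m : ℝ) ^ 2) * σ2 * t := by ring
      rw [this]
      positivity
  have hgood : μ.real {ω | Xm ω ∈ P.filter fun A => ¬ M + ε < g A} =
      (P.filter fun A => ¬ M + ε < g A).card / (P.card : ℝ) := by
    rw [hXm.measureReal_mem (Finset.filter_subset _ _), hP, Finset.card_powersetCard]
  have hcount : ((P.filter fun A => M + ε < g A).card : ℝ) +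
      (P.filter fun A => ¬ M + ε < g A).card = P.card := by
    exact_mod_cast Finset.card_filter_add_card_filter_not (s := P) (fun A => M + ε < g A)
  calc 1 - Real.exp (-t) < (P.filter fun A => ¬ M + ε < g A).card / (P.card : ℝ) := by
        rw [lt_div_iff₀ hZ]
        linarith
    _ = μ.real {ω | Xm ω ∈ P.filter fun A => ¬ M + ε < g A} := hgood.symm
    _ ≤ _ := by
        -- Monotonicity suffices, so measurability of the event in the conclusion plays no role.
        refine measureReal_mono fun ω hω h hh => ?_
        have h1 := not_lt.1 (Finset.mem_filter.1 hω).2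
        exact (le_ciSup (bddAbove_range_deviation hℓ φ H XN (Xm ω)) ⟨h, hh⟩).trans h1
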